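/- **Setting.** Fix three disjoint countably infinite sets: numerals (one numeral $\overline n$ for each integer $n$), symbolic constants, and general variables; integer variables form a further countably infinite set, disjoint from these. Numerals and symbolic constants are called precomputed terms. Fix a total order on precomputed terms such that $\overline m<\overline n$ iff $m<n$, and every precomputed term lying strictly between two numerals is a numeral. **Regular programs.** Regular terms are built from numerals and general variables with $+,-,\times$. A regular atom is $p(\mathbf t)$, where $p$ is a symbolic constant and $\mathbf t$ is a tuple of symbolic constants and regular terms. A regular comparison is either $t_1\prec t_2$, where each $t_i$ is a symbolic constant or a regular term and $\prec$ is one of $=,\neq,<,>,\le,\ge$, or $t_1=t_2\,..\,t_3$ with regular terms $t_1,t_2,t_3$. A regular rule is $\mathit{Head}\leftarrow\mathit{Body}$, where $\mathit{Head}$ is $A$, $\{A\}$ (for a regular atom $A$) or empty (the rule is then a constraint), and $\mathit{Body}$ is a finite, possibly empty, conjunction of regular atoms, regular atoms preceded by $\mathit{not}$, and regular comparisons. A regular program is a finite set of regular rules. A predicate symbol $p/n$ occurs in $\Pi$ if an atom $p(t_1,\dots,t_n)$ occurs in a rule of $\Pi$. The Herbrand base of $\Pi$ is the set of atoms $p(t_1,\dots,t_n)$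 such that $p/n$ occurs in $\Pi$ and all $t_i$ are precomputed. **Stable models** (semantics of Abstract Gringo). The set $[t]$ of values of a ground term is defined by $[t]=\{t\}$ if $t$ is precomputed; $[t_1\circ t_2]=\{\overline{m\circ n}:\overline m\in[t_1],\ \overline n\in[t_2]\}$ for $\circ\in\{+,-,\times\}$; and $[t_1\,..\,t_2]=\{\overline k: m\le k\le n \text{ for some } \overline m\in[t_1],\ \overline n\in[t_2]\}$; for tuples, $[t_1,\dots,t_n]=[t_1]\times\cdots\times[t_n]$. For ground expressions, in a body $\tau(p(\mathbf t))=\bigvee_{\mathbf r\in[\mathbf t]}p(\mathbf r)$ and $\tau(\mathit{not}\ p(\mathbf t))=\bigvee_{\mathbf r\in[\mathbf t]}\neg p(\mathbf r)$; a comparison $t_1\prec t_2$ becomes $\top$ if $r_1\prec r_2$ for some $r_1\in[t_1]$, $r_2\in[t_2]$, and $\bot$ otherwise (also when $\prec$ is $=$ and $t_2$ is an interval); a body becomes the conjunction of the translations of its members. A head $p(\mathbf t)$ becomes $\bigwedge_{\mathbf r\in[\mathbf t]}p(\mathbf r)$, a head $\{p(\mathbf t)\}$ becomes $\bigwedge_{\mathbf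 r\in[\mathbf t]}(p(\mathbf r)\lor\neg p(\mathbf r))$, and an empty head becomes $\bot$. A ground rule becomes the implication $\tau(\mathit{Body})\to\tau(\mathit{Head})$. A set $S$ of atoms $p(\mathbf r)$ with precomputed arguments is a stable model of $\Pi$ if it is a stable model, in the sense of infinitary propositional logic (minimal, with respect to inclusion, among the models of the reduct with respect to $S$), of the set of translations of all rules obtained from rules of $\Pi$ by substituting precomputed terms for variables. **Natural completion.** The two-sorted signature $\sigma_\Pi$ has the sort *general* and its subsort *integer*; numerals are constants of sort *integer*, symbolic constants are constants of sort *general*, $+,-,\times$ are binary function symbols on sort *integer*, the predicate symbols $p/n$ occurring in $\Pi$ take $n$ arguments of sort *general*, and $\neq,<,>,\le,\ge$ are binary predicate symbols with arguments of sort *general*. A variable is critical in a rule $R$ if it has an occurrence in $R$ in the scope of an arithmetic operation or in a comparison of the form $t_1=t_2\,..\,t_3$. For each rule $R$ choose pairwise distinct integer variables for its critical variables. Let $f_R$ replace each critical variable by the integer variable chosen for it, turn $\mathit{not}$ into $\neg$, and turn $t_1=t_2\,..\,t_3$ into $f_R(t_2)\le f_R(t_1)\le f_R(t_3)$. For $p/n$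 occurring in $\Pi$, choose a tuple $\mathbf V$ of $n$ distinct general variables not occurring in $\Pi$. The completed definition of $p/n$ is $$\forall\mathbf V\Bigl(p(\mathbf V)\leftrightarrow\bigvee_R\exists\mathbf U_R\,F_R\Bigr),$$ where $R$ ranges over the rules of $\Pi$ whose head is $p(\mathbf t)$ or $\{p(\mathbf t)\}$ with $\mathbf t$ of length $n$; $F_R$ is $f_R(\mathit{Body})\land\mathbf V=f_R(\mathbf t)$ if the head is $p(\mathbf t)$, and $f_R(\mathit{Body})\land\mathbf V=f_R(\mathbf t)\land p(\mathbf V)$ if it is $\{p(\mathbf t)\}$; and $\mathbf U_R$ lists all variables occurring in $f_R(\mathit{Body})$ or $f_R(\mathbf t)$. $\mathrm{NCOMP}(\Pi)$ consists of the completed definitions of all predicate symbols occurring in $\Pi$ and, for each constraint $R$ in $\Pi$, with body $\mathit{Body}$, the universal closure of $\neg f_R(\mathit{Body})$. **Standard interpretation.** For a subset $S$ of the Herbrand base of $\Pi$, $S^\uparrow$ is the interpretation of $\sigma_\Pi$ in which the universe of sort *general* is the set of precomputed terms; the universe of sort *integer* is the set of numerals; every precomputed term denotes itself; $+,-,\times$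 are interpreted as in integer arithmetic; $\neq$ is interpreted as inequality and $<,>,\le,\ge$ according to the fixed total order; and $p(\mathbf r)$ is true iff $p(\mathbf r)\in S$. **Theorem.** For any regular program $\Pi$ and any subset $S$ of its Herbrand base, if $S$ is a stable model of $\Pi$, then $S^\uparrow$ satisfies $\mathrm{NCOMP}(\Pi)$ (for every choice of the variables used in its construction). -/

import Mathlib

universe u v w x

namespace RegularASP

/-! ### Regular programs -/

/-- Precomputed terms: numerals (in bijection with the integers) and symbolic constants. -/
inductive PTerm (C : Type u) : Type u
  | num (n : ℤ)
  | sym (c : C)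

/-- Regular terms: built from numerals and general variables by `+`, `-`, `×`. -/
inductive RTerm (G : Type v) : Type v
  | num (n : ℤ)
  | var (X : G)
  | add (s t : RTerm G)
  | sub (s t : RTerm G)
  | mul (s t : RTerm G)

/-- A symbolic constant or a regular term. -/
inductive Arg (C : Type u) (G : Type v) : Type (max u v)
  | sym (c : C)
  | term (t : RTerm G)

/-- A predicate symbol `p/n`. -/
@[ext] structure PredSym (C : Type u) : Type u where
  name : C
  arity : ℕ

/-- A regular atom `p(t₁,…,tₙ)`. -/
structure Atom (C : Type u) (G : Type v) : Type (max u v) where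
  name : C
  args : List (Arg C G)

/-- The comparison symbols other than equality. -/
inductive Rel : Type
  | ne | lt | gt | le | ge

/-- Regular comparisons: `s = t`, `s ≺ t` and `t₁ = t₂..t₃`. -/
inductive Comparison (C : Type u) (G : Type v) : Type (max u v)
  | eq (s t : Arg C G)
  | rel (r : Rel) (s t : Arg C G)
  | interval (t₁ t₂ t₃ : RTerm G)

/-- Conjunctive terms of the body of a rule: `A`, `not A`, or a regular comparison. -/
inductive Literal (C : Type u) (G : Type v) : Type (max u v)
  | pos (A : Atom C G)
  | neg (A : Atom C G)
  | cmp (c : Comparison C G)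

/-- Heads of rules: `A`, `{A}`, or empty. -/
inductive Head (C : Type u) (G : Type v) : Type (max u v)
  | basic (A : Atom C G)
  | choice (A : Atom C G)
  | constraint

/-- A regular rule `Head ← Body`. -/
structure Rule (C : Type u) (G : Type v) : Type (max u v) where
  head : Head C G
  body : List (Literal C G)

/-- A regular program: a finite set of regular rules. -/
abbrev Program (C : Type u) (G : Type v) : Type (max u v) := Finset (Rule C G)

section Variables

variable {C : Type u} {G : Type v}

def Atom.predSym (A : Atom C G) : PredSym C := ⟨A.name, A.args.length⟩

/-- The predicate symbols that occur in a conjunctive term. -/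
def Literal.predSyms : Literal C G → Set (PredSym C)
  | .pos A => {A.predSym}
  | .neg A => {A.predSym}
  | .cmp _ => ∅

def Head.predSyms : Head C G → Set (PredSym C)
  | .basic A => {A.predSym}
  | .choice A => {A.predSym}
  | .constraint => ∅

def Rule.predSyms (R : Rule C G) : Set (PredSym C) :=
  R.head.predSyms ∪ {q | ∃ B ∈ R.body, q ∈ B.predSyms}

/-- The predicate symbols that occur in a program.  They are the only part of the signature
`σ_Π` that depends on the program `P`. -/
def Program.predSyms (P : Program C G) : Set (PredSym C) :=
  {q | ∃ R ∈ P, q ∈ R.predSyms}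

/-- The variables that occur in a regular term. -/
def RTerm.vars : RTerm G → Set G
  | .num _ => ∅
  | .var X => {X}
  | .add s t => s.vars ∪ t.vars
  | .sub s t => s.vars ∪ t.vars
  | .mul s t => s.vars ∪ t.vars

/-- The variables that have an occurrence in the scope of an arithmetic operation. -/
def RTerm.arithVars : RTerm G → Set G
  | .num _ => ∅
  | .var _ => ∅
  | .add s t => s.vars ∪ t.vars
  | .sub s t => s.vars ∪ t.vars
  | .mul s t => s.vars ∪ t.vars

def Arg.vars : Arg C G → Set G
  | .sym _ => ∅
  | .term t => t.vars

def Arg.arithVars : Arg C G → Set G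
  | .sym _ => ∅
  | .term t => t.arithVars

def Atom.vars (A : Atom C G) : Set G := {X | ∃ a ∈ A.args, X ∈ a.vars}

def Atom.arithVars (A : Atom C G) : Set G := {X | ∃ a ∈ A.args, X ∈ a.arithVars}

def Comparison.vars : Comparison C G → Set G
  | .eq s t => s.vars ∪ t.vars
  | .rel _ s t => s.vars ∪ t.vars
  | .interval t₁ t₂ t₃ => t₁.vars ∪ t₂.vars ∪ t₃.vars

/-- Variables in the scope of an arithmetic operation or in an interval comparison. -/
def Comparison.criticalVars : Comparison C G → Set G
  | .eq s t => s.arithVars ∪ t.arithVars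
  | .rel _ s t => s.arithVars ∪ t.arithVars
  | .interval t₁ t₂ t₃ => t₁.vars ∪ t₂.vars ∪ t₃.vars

def Literal.vars : Literal C G → Set G
  | .pos A => A.vars
  | .neg A => A.vars
  | .cmp c => c.vars

def Literal.criticalVars : Literal C G → Set G
  | .pos A => A.arithVars
  | .neg A => A.arithVars
  | .cmp c => c.criticalVars

def Head.vars : Head C G → Set G
  | .basic A => A.vars
  | .choice A => A.vars
  | .constraint => ∅

def Head.criticalVars : Head C G → Set G
  | .basic A => A.arithVars
  | .choice A => A.arithVars
  | .constraint => ∅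

def Rule.vars (R : Rule C G) : Set G :=
  R.head.vars ∪ {X | ∃ B ∈ R.body, X ∈ B.vars}

/-- The critical variables of a rule. -/
def Rule.criticalVars (R : Rule C G) : Set G :=
  R.head.criticalVars ∪ {X | ∃ B ∈ R.body, X ∈ B.criticalVars}

/-- The (general) variables that occur in a program. -/
def Program.vars (P : Program C G) : Set G := {X | ∃ R ∈ P, X ∈ R.vars}

end Variables

/-! ### Infinitary propositional formulas and their stable models -/

/-- Infinitary propositional formulas over the set of atoms `A`. -/
inductive InfFormula (A : Type u) : Type (u + 1)
  | atom (a : A)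
  | falsum
  | conj {ι : Type u} (F : ι → InfFormula A)
  | disj {ι : Type u} (F : ι → InfFormula A)
  | imp (F H : InfFormula A)

namespace InfFormula

variable {A : Type u}

def neg (F : InfFormula A) : InfFormula A := imp F falsum

/-- The empty conjunction. -/
def verum : InfFormula A := conj (fun i : PEmpty.{u + 1} => i.elim)

/-- The disjunction of two formulas. -/
def or (F H : InfFormula A) : InfFormula A :=
  disj (fun b : ULift.{u} Bool => if b.down then F else H)

/-- The conjunction of a finite list of formulas. -/
def conjList (l : List (InfFormula A)) : InfFormula A :=
  conj (fun i : ULift.{u} (Fin l.length) => l.get i.down)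

/-- Satisfaction of an infinitary formula by a set of atoms. -/
def Sat (I : Set A) : InfFormula A → Prop
  | atom a => a ∈ I
  | falsum => False
  | conj F => ∀ i, Sat I (F i)
  | disj F => ∃ i, Sat I (F i)
  | imp F H => Sat I F → Sat I H

open Classical in
/-- The reduct of an infinitary formula with respect to a set `I` of atoms. -/
noncomputable def reduct (I : Set A) : InfFormula A → InfFormula A
  | atom a => if a ∈ I then atom a else falsum
  | falsum => falsum
  | conj F => conj (fun i => reduct I (F i))
  | disj F => disj (fun i => reduct I (F i))
  | imp F H => if Sat I (imp F H) then imp (reduct I F) (reduct I H) else falsum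

/-- `I` is a stable model of the set `T` of formulas: it is minimal with respect to inclusion
among the sets of atoms that satisfy the reducts, with respect to `I`, of all members of `T`. -/
def IsStable (T : Set (InfFormula A)) (I : Set A) : Prop :=
  Minimal (fun J : Set A => ∀ F ∈ T, Sat J (reduct I F)) I

end InfFormula

/-! ### Stable models of regular programs (the semantics of Abstract Gringo)

A substitution `θ` of precomputed terms for variables turns a rule into one of its ground
instances; the definitions below describe the values of the terms of that instance and its
translation `τ` into an infinitary formula. -/

/-- Ground atoms `p(t₁,…,tₙ)` whose arguments are precomputed terms. -/
structure GroundAtom (C : Type u) : Type u where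
  name : C
  args : List (PTerm C)

section Gringo

variable {C : Type u} {G : Type v}

/-- The set `[tθ]` of values of the ground term `tθ`. -/
def RTerm.values (θ : G → PTerm C) : RTerm G → Set (PTerm C)
  | .num n => {.num n}
  | .var X => {θ X}
  | .add s t => {r | ∃ m n : ℤ, .num m ∈ s.values θ ∧ .num n ∈ t.values θ ∧ r = .num (m + n)}
  | .sub s t => {r | ∃ m n : ℤ, .num m ∈ s.values θ ∧ .num n ∈ t.values θ ∧ r = .num (m - n)}
  | .mul s t => {r | ∃ m n : ℤ, .num m ∈ s.values θ ∧ .num n ∈ t.values θ ∧ r = .num (m * n)}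

/-- The set of values of the ground interval `sθ..tθ`. -/
def intervalValues (θ : G → PTerm C) (s t : RTerm G) : Set (PTerm C) :=
  {r | ∃ m n k : ℤ, .num m ∈ s.values θ ∧ .num n ∈ t.values θ ∧ m ≤ k ∧ k ≤ n ∧ r = .num k}

def Arg.values (θ : G → PTerm C) : Arg C G → Set (PTerm C)
  | .sym c => {.sym c}
  | .term t => t.values θ

/-- The set of values of a tuple: the Cartesian product of the sets of values of its members. -/
def tupleValues (θ : G → PTerm C) (l : List (Arg C G)) : Set (List (PTerm C)) :=
  {r | List.Forall₂ (fun a t => t ∈ a.values θ) l r}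

/-- The relation between precomputed terms that is denoted by a comparison symbol. -/
def Rel.Holds [LinearOrder (PTerm C)] : Rel → PTerm C → PTerm C → Prop
  | .ne, s, t => s ≠ t
  | .lt, s, t => s < t
  | .gt, s, t => s > t
  | .le, s, t => s ≤ t
  | .ge, s, t => s ≥ t

variable [LinearOrder (PTerm C)]

/-- The condition under which `τ` turns a ground comparison into `⊤`. -/
def Comparison.Holds (θ : G → PTerm C) : Comparison C G → Prop
  | .eq s t => ∃ a ∈ s.values θ, ∃ b ∈ t.values θ, a = b
  | .rel r s t => ∃ a ∈ s.values θ, ∃ b ∈ t.values θ, r.Holds a b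
  | .interval t₁ t₂ t₃ => ∃ a ∈ t₁.values θ, ∃ b ∈ intervalValues θ t₂ t₃, a = b

open Classical in
/-- The translation `τ` of (a ground instance of) a conjunctive term of a body. -/
noncomputable def Literal.tau (θ : G → PTerm C) : Literal C G → InfFormula (GroundAtom C)
  | .pos A => .disj (fun r : tupleValues θ A.args => .atom ⟨A.name, r⟩)
  | .neg A => .disj (fun r : tupleValues θ A.args => .neg (.atom ⟨A.name, r⟩))
  | .cmp c => if c.Holds θ then .verum else .falsum

/-- The translation `τ` of (a ground instance of) a head. -/
def Head.tau (θ : G → PTerm C) : Head C G → InfFormula (GroundAtom C)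
  | .basic A => .conj (fun r : tupleValues θ A.args => .atom ⟨A.name, r⟩)
  | .choice A => .conj (fun r : tupleValues θ A.args =>
      .or (.atom ⟨A.name, r⟩) (.neg (.atom ⟨A.name, r⟩)))
  | .constraint => .falsum

noncomputable def Rule.tau (θ : G → PTerm C) (R : Rule C G) : InfFormula (GroundAtom C) :=
  .imp (.conjList (R.body.map (Literal.tau θ))) (R.head.tau θ)

/-- The set of the translations of all ground instances of the rules of a program. -/
def Program.tau (P : Program C G) : Set (InfFormula (GroundAtom C)) :=
  {F | ∃ R ∈ P, ∃ θ : G → PTerm C, F = R.tau θ}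

/-- Stable models of a regular program. -/
def Program.IsStableModel (P : Program C G) (S : Set (GroundAtom C)) : Prop :=
  InfFormula.IsStable P.tau S

end Gringo

/-- The Herbrand base of a program. -/
def Program.herbrandBase {C : Type u} {G : Type v} (P : Program C G) : Set (GroundAtom C) :=
  {A | (⟨A.name, A.args.length⟩ : PredSym C) ∈ P.predSyms}

/-! ### Two-sorted formulas

`C`, `G` and `N` are the sets of symbolic constants, general variables and integer variables. -/

inductive Var (G : Type v) (N : Type w) : Type (max v w)
  | gen (X : G)
  | int (I : N)

/-- Terms of the sort *integer*. -/
inductive ITerm (N : Type w) : Type w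
  | num (n : ℤ)
  | var (I : N)
  | add (s t : ITerm N)
  | sub (s t : ITerm N)
  | mul (s t : ITerm N)

/-- Terms of the sort *general*, which has *integer* as a subsort. -/
inductive GTerm (C : Type u) (G : Type v) (N : Type w) : Type (max u v w)
  | sym (c : C)
  | var (X : G)
  | int (t : ITerm N)

/-- First-order formulas over the two-sorted signature whose predicate symbols, besides the
comparison symbols, are the elements of `σ`.  Equality is a logical symbol. -/
inductive Formula (C : Type u) (G : Type v) (N : Type w) (σ : Set (PredSym C)) :
    Type (max u v w)
  | falsum
  | eq (s t : GTerm C G N)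
  | rel (r : Rel) (s t : GTerm C G N)
  | pred (p : C) (args : List (GTerm C G N)) (h : ⟨p, args.length⟩ ∈ σ)
  | and (φ ψ : Formula C G N σ)
  | or (φ ψ : Formula C G N σ)
  | imp (φ ψ : Formula C G N σ)
  | all (x : Var G N) (φ : Formula C G N σ)
  | ex (x : Var G N) (φ : Formula C G N σ)

/-- Interpretations of the two-sorted signature with the predicate symbols `σ`.  The universe
`Int` of the subsort *integer* is a subset of the universe `Gen` of the sort *general*;
a predicate symbol `p/n` from `σ` is interpreted by a relation on tuples of length `n`. -/
structure Interpretation (C : Type u) (σ : Set (PredSym C)) where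
  Gen : Type x
  Int : Set Gen
  num : ℤ → Int
  sym : C → Gen
  add : Int → Int → Int
  sub : Int → Int → Int
  mul : Int → Int → Int
  rel : Rel → Gen → Gen → Prop
  pred : (p : C) → (args : List Gen) → ⟨p, args.length⟩ ∈ σ → Prop

section Semantics

variable {C : Type u} {G : Type v} {N : Type w} {σ : Set (PredSym C)}

/-- Assignments of values to general and to integer variables. -/
structure Assignment (G : Type v) (N : Type w) (M : Interpretation.{u, x} C σ) where
  gen : G → M.Gen
  int : N → M.Int

open Classical in
noncomputable def Assignment.setGen {M : Interpretation.{u, x} C σ} (e : Assignment G N M)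
    (X : G) (a : M.Gen) : Assignment G N M :=
  ⟨Function.update e.gen X a, e.int⟩

open Classical in
noncomputable def Assignment.setInt {M : Interpretation.{u, x} C σ} (e : Assignment G N M)
    (I : N) (a : M.Int) : Assignment G N M :=
  ⟨e.gen, Function.update e.int I a⟩

def ITerm.eval {M : Interpretation.{u, x} C σ} (e : Assignment G N M) : ITerm N → M.Int
  | .num n => M.num n
  | .var I => e.int I
  | .add s t => M.add (s.eval e) (t.eval e)
  | .sub s t => M.sub (s.eval e) (t.eval e)
  | .mul s t => M.mul (s.eval e) (t.eval e)

def GTerm.eval {M : Interpretation.{u, x} C σ} (e : Assignment G N M) : GTerm C G N → M.Gen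
  | .sym c => M.sym c
  | .var X => e.gen X
  | .int t => (t.eval e : M.Gen)

/-- Satisfaction of a formula under an assignment. -/
def Formula.Holds (M : Interpretation.{u, x} C σ) :
    Formula C G N σ → Assignment G N M → Prop
  | .falsum, _ => False
  | .eq s t, e => s.eval e = t.eval e
  | .rel r s t, e => M.rel r (s.eval e) (t.eval e)
  | .pred p args h, e => M.pred p (args.map (GTerm.eval e)) (by simpa using h)
  | .and φ ψ, e => φ.Holds M e ∧ ψ.Holds M e
  | .or φ ψ, e => φ.Holds M e ∨ ψ.Holds M e
  | .imp φ ψ, e => φ.Holds M e → ψ.Holds M e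
  | .all (.gen X) φ, e => ∀ a : M.Gen, φ.Holds M (e.setGen X a)
  | .all (.int I) φ, e => ∀ a : M.Int, φ.Holds M (e.setInt I a)
  | .ex (.gen X) φ, e => ∃ a : M.Gen, φ.Holds M (e.setGen X a)
  | .ex (.int I) φ, e => ∃ a : M.Int, φ.Holds M (e.setInt I a)

/-- `M` satisfies the sentence `φ` (the assignment is irrelevant when `φ` has no free
variables). -/
def Interpretation.Satisfies (M : Interpretation.{u, x} C σ) (φ : Formula C G N σ) : Prop :=
  ∀ e : Assignment G N M, φ.Holds M e

/-! ### Variables and derived connectives -/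

def ITerm.vars : ITerm N → List (Var G N)
  | .num _ => []
  | .var I => [.int I]
  | .add s t => s.vars ++ t.vars
  | .sub s t => s.vars ++ t.vars
  | .mul s t => s.vars ++ t.vars

def GTerm.vars : GTerm C G N → List (Var G N)
  | .sym _ => []
  | .var X => [.gen X]
  | .int t => t.vars

open Classical in
/-- The free variables of a formula. -/
noncomputable def Formula.freeVars : Formula C G N σ → List (Var G N)
  | .falsum => []
  | .eq s t => s.vars ++ t.vars
  | .rel _ s t => s.vars ++ t.vars
  | .pred _ args _ => args.flatMap GTerm.vars
  | .and φ ψ => φ.freeVars ++ ψ.freeVars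
  | .or φ ψ => φ.freeVars ++ ψ.freeVars
  | .imp φ ψ => φ.freeVars ++ ψ.freeVars
  | .all y φ => φ.freeVars.filter (fun z => z ≠ y)
  | .ex y φ => φ.freeVars.filter (fun z => z ≠ y)

namespace Formula

def neg (φ : Formula C G N σ) : Formula C G N σ := imp φ falsum

def verum : Formula C G N σ := neg falsum

def iff (φ ψ : Formula C G N σ) : Formula C G N σ := and (imp φ ψ) (imp ψ φ)

/-- The conjunction of a list of formulas. -/
def bigAnd : List (Formula C G N σ) → Formula C G N σ
  | [] => verum
  | φ :: l => and φ (bigAnd l)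

/-- The disjunction of a list of formulas. -/
def bigOr : List (Formula C G N σ) → Formula C G N σ
  | [] => falsum
  | φ :: l => or φ (bigOr l)

def allList (l : List (Var G N)) (φ : Formula C G N σ) : Formula C G N σ := l.foldr all φ

def exList (l : List (Var G N)) (φ : Formula C G N σ) : Formula C G N σ := l.foldr ex φ

/-- Equality of two tuples of the same length. -/
def eqTuple (l l' : List (GTerm C G N)) : Formula C G N σ := bigAnd (List.zipWith eq l l')

open Classical in
/-- The universal closure of a formula. -/
noncomputable def closure (φ : Formula C G N σ) : Formula C G N σ :=
  allList φ.freeVars.dedup φ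

end Formula

end Semantics

/-! ### Natural translation

`K` is the set of critical variables of a rule, and `f` assigns integer variables to them. -/

section Translation

variable {C : Type u} {G : Type v} {N : Type w} {σ : Set (PredSym C)}

/-- Replaces every variable `X` by the integer variable `f X`. -/
def RTerm.toITerm (f : G → N) : RTerm G → ITerm N
  | .num n => .num n
  | .var X => .var (f X)
  | .add s t => .add (s.toITerm f) (t.toITerm f)
  | .sub s t => .sub (s.toITerm f) (t.toITerm f)
  | .mul s t => .mul (s.toITerm f) (t.toITerm f)

open Classical in
/-- Replaces every critical variable `X` by the integer variable `f X`.  (All variables of a term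
that contains an arithmetic operation are critical.) -/
noncomputable def RTerm.natural (K : Set G) (f : G → N) : RTerm G → GTerm C G N
  | .var X => if X ∈ K then .int (.var (f X)) else .var X
  | t => .int (t.toITerm f)

noncomputable def Arg.natural (K : Set G) (f : G → N) : Arg C G → GTerm C G N
  | .sym c => .sym c
  | .term t => t.natural K f

noncomputable def Atom.natural (K : Set G) (f : G → N) (A : Atom C G) (h : A.predSym ∈ σ) :
    Formula C G N σ :=
  .pred A.name (A.args.map (Arg.natural K f)) (by simpa [Atom.predSym] using h)

noncomputable def Comparison.natural (K : Set G) (f : G → N) :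
    Comparison C G → Formula C G N σ
  | .eq s t => .eq (s.natural K f) (t.natural K f)
  | .rel r s t => .rel r (s.natural K f) (t.natural K f)
  | .interval t₁ t₂ t₃ =>
      .and (.rel .le (t₂.natural K f) (t₁.natural K f))
        (.rel .le (t₁.natural K f) (t₃.natural K f))

noncomputable def Literal.natural (K : Set G) (f : G → N) :
    (B : Literal C G) → B.predSyms ⊆ σ → Formula C G N σ
  | .pos A, h => A.natural K f (h rfl)
  | .neg A, h => .neg (A.natural K f (h rfl))
  | .cmp c, _ => c.natural K f

theorem Rule.predSyms_of_mem_body {R : Rule C G} (h : R.predSyms ⊆ σ) {B : Literal C G}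
    (hB : B ∈ R.body) : B.predSyms ⊆ σ :=
  fun _ hq => h (Or.inr ⟨B, hB, hq⟩)

/-- The formula `f_R(Body)`. -/
noncomputable def Rule.naturalBody (f : G → N) (R : Rule C G) (h : R.predSyms ⊆ σ) :
    Formula C G N σ :=
  .bigAnd (R.body.attach.map fun B =>
    B.1.natural R.criticalVars f (Rule.predSyms_of_mem_body h B.2))

/-- The tuple `f_R(t)`, where `t` is the tuple of arguments of the atom in the head (empty
for constraints). -/
noncomputable def Rule.naturalHeadArgs (f : G → N) (R : Rule C G) : List (GTerm C G N) :=
  match R.head with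
  | .basic A => A.args.map (Arg.natural R.criticalVars f)
  | .choice A => A.args.map (Arg.natural R.criticalVars f)
  | .constraint => []

/-- The formula `F_R`, for a rule `R` that is not a constraint; `V` is the tuple of variables
of the completed definition, and `pV` is the atomic formula `p(V)`. -/
noncomputable def Rule.completionBody (f : G → N) (R : Rule C G) (h : R.predSyms ⊆ σ)
    (V : List (GTerm C G N)) (pV : Formula C G N σ) : Formula C G N σ :=
  match R.head with
  | .choice _ => .and (.and (R.naturalBody f h) (.eqTuple V (R.naturalHeadArgs f))) pV
  | _ => .and (R.naturalBody f h) (.eqTuple V (R.naturalHeadArgs f))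

open Classical in
/-- The list `U_R` of all variables that occur in `f_R(Body)` or in `f_R(t)` (the formula
`f_R(Body)` is quantifier-free, so that its variables are its free variables). -/
noncomputable def Rule.completionVars (f : G → N) (R : Rule C G) (h : R.predSyms ⊆ σ) :
    List (Var G N) :=
  ((R.naturalBody f h).freeVars ++ (R.naturalHeadArgs f).flatMap GTerm.vars).dedup

end Translation

/-! ### Natural completion -/

section Completion

variable {C : Type u} {G : Type v} {N : Type w}

/-- The choices of variables made in the construction of the natural completion of `P`: for
every rule, pairwise distinct integer variables that replace its critical variables, and for
every predicate symbol `p/n` occurring in `P`, a tuple of `n` distinct general variables that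
do not occur in `P`. -/
structure CompletionChoice (P : Program C G) (N : Type w) where
  f : Rule C G → G → N
  f_injOn : ∀ R ∈ P, Set.InjOn (f R) R.criticalVars
  V : (q : PredSym C) → Fin q.arity → G
  V_injective : ∀ q ∈ P.predSyms, Function.Injective (V q)
  V_fresh : ∀ q ∈ P.predSyms, ∀ i, V q i ∉ P.vars

theorem Program.predSyms_of_mem {P : Program C G} {R : Rule C G} (h : R ∈ P) :
    R.predSyms ⊆ P.predSyms :=
  fun _ hq => ⟨R, h, hq⟩

open Classical in
/-- The definition of `p/n` in `P`: the rules with the head `p(t)` or `{p(t)}`, where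
`t` has length `n`. -/
noncomputable def Program.definition (P : Program C G) (q : PredSym C) :
    Finset {R : Rule C G // R ∈ P} :=
  P.attach.filter fun R => q ∈ R.1.head.predSyms

/-- The tuple `V` for the predicate symbol `q`. -/
def CompletionChoice.terms {P : Program C G} (c : CompletionChoice P N) (q : PredSym C) :
    List (GTerm C G N) :=
  List.ofFn fun i => GTerm.var (c.V q i)

/-- The atomic formula `p(V)`. -/
def CompletionChoice.atom {P : Program C G} (c : CompletionChoice P N) (q : PredSym C)
    (hq : q ∈ P.predSyms) : Formula C G N P.predSyms :=
  .pred q.name (c.terms q) (by simpa [CompletionChoice.terms] using hq)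

/-- The completed definition of `q` in `P`. -/
noncomputable def completedDefinition (P : Program C G) (c : CompletionChoice P N)
    (q : PredSym C) (hq : q ∈ P.predSyms) : Formula C G N P.predSyms :=
  .allList (List.ofFn fun i => Var.gen (c.V q i))
    (.iff (c.atom q hq)
      (.bigOr ((P.definition q).toList.map fun R =>
        .exList (R.1.completionVars (c.f R.1) (Program.predSyms_of_mem R.2))
          (R.1.completionBody (c.f R.1) (Program.predSyms_of_mem R.2)
            (c.terms q) (c.atom q hq)))))

/-- The natural completion of `P`. -/
noncomputable def NCOMP (P : Program C G) (c : CompletionChoice P N) :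
    Set (Formula C G N P.predSyms) :=
  {φ | ∃ (q : PredSym C) (hq : q ∈ P.predSyms), φ = completedDefinition P c q hq} ∪
  {φ | ∃ (R : Rule C G) (hR : R ∈ P), R.head = .constraint ∧
    φ = Formula.closure (.neg (R.naturalBody (c.f R) (Program.predSyms_of_mem hR)))}

end Completion

/-! ### The standard interpretation -/

section Standard

variable {C : Type u} {G : Type v}

/-- The set of numerals. -/
def numerals (C : Type u) : Set (PTerm C) := Set.range PTerm.num

/-- The numeral of an integer. -/
def numeral (n : ℤ) : numerals C := ⟨.num n, n, rfl⟩

/-- The integer that corresponds to a numeral. -/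
def numeralValue : numerals C → ℤ
  | ⟨.num n, _⟩ => n
  | ⟨.sym _, h⟩ => absurd h (by simp [numerals])

/-- The interpretation `S^↑` of the signature of `P`. -/
abbrev Program.standard [LinearOrder (PTerm C)] (P : Program C G) (S : Set (GroundAtom C)) :
    Interpretation.{u, u} C P.predSyms where
  Gen := PTerm C
  Int := numerals C
  num := numeral
  sym := PTerm.sym
  add a b := numeral (numeralValue a + numeralValue b)
  sub a b := numeral (numeralValue a - numeralValue b)
  mul a b := numeral (numeralValue a * numeralValue b)
  rel := Rel.Holds
  pred p args _ := (⟨p, args⟩ : GroundAtom C) ∈ S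

end Standard

end RegularASP

open RegularASP

namespace RegularASP

universe u₁ u₂ u₃ u₄

/-! ### Stable models are supported -/

namespace InfFormula

variable {A : Type u₁}

/-! Two facts about a stable model `S` carry the theorem: it satisfies every ground instance of
every rule, and it is supported, that is, each of its atoms comes from the head of an instance whose
body holds in `S`. The first gives the constraints and the right-to-left half of the completed
definitions; the second gives the left-to-right half. Support comes from minimality: if `a ∈ S`, the
reduct of some instance fails at `S \ {a}`, and since a formula whose reduct holds anywhere is
satisfied by `S` itself, the body of this instance holds in `S` while its head must involve `a`.

It remains to match instances of rules with assignments to the variables of the two-sorted formulas.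
Arithmetic on a symbolic constant has no values, so in an instance with a true body and a nonempty
set of head tuples every critical variable stands for a numeral; the substitution is therefore an
assignment to integer and general variables (`Assignment.exists_represents`). Conversely, every
assignment can be read as a substitution (`Assignment.exists_substitution`). Under this
correspondence (`Assignment.Represents`) each term has exactly one value, so the big disjunctions
and conjunctions of `τ` have one member each and agree with the natural translation
(`Literal.holds_natural_iff`).

The remaining work is with quantifiers: the variables `V` are fresh, hence not among those bound by
`∃ U_R`, and keep their values there. -/

theorem sat_of_sat_reduct {I J : Set A} (F : InfFormula A) :
    Sat J (reduct I F) → Sat I F := by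
  induction F with
  | atom a =>
    by_cases h : a ∈ I <;> simp [reduct, Sat, h]
  | falsum => exact id
  | conj F ih => exact fun h i => ih i (h i)
  | disj F ih => exact fun ⟨i, h⟩ => ⟨i, ih i h⟩
  | imp F H _ _ =>
    by_cases h : Sat I (imp F H)
    · exact fun _ => h
    · rw [reduct, if_neg h]
      exact False.elim

/-- Taking the reduct with respect to `I` only replaces parts that are false in `I` by `⊥`, which
`I` itself cannot detect. Hence a stable model is a model. -/
theorem sat_reduct_self {I : Set A} (F : InfFormula A) : Sat I (reduct I F) ↔ Sat I F := by
  refine ⟨sat_of_sat_reduct F, ?_⟩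
  induction F with
  | atom a =>
    intro h
    have h' : a ∈ I := h
    simp [reduct, Sat, h']
  | falsum => exact id
  | conj F ih => exact fun h i => ih i (h i)
  | disj F ih => exact fun ⟨i, h⟩ => ⟨i, ih i h⟩
  | imp F H _ ihH =>
    intro h
    rw [reduct, if_pos h]
    exact fun hF => ihH (h (sat_of_sat_reduct F hF))

theorem IsStable.sat {T : Set (InfFormula A)} {I : Set A} (h : IsStable T I)
    {F : InfFormula A} (hF : F ∈ T) : Sat I F :=
  (sat_reduct_self F).1 (h.prop F hF)

/-- Minimality is needed only against the removal of a single atom. -/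
theorem IsStable.exists_not_sat_reduct {T : Set (InfFormula A)} {I : Set A} (h : IsStable T I)
    {a : A} (ha : a ∈ I) : ∃ F ∈ T, ¬ Sat (I \ {a}) (reduct I F) := by
  by_contra! hT
  exact (h.le_of_le hT Set.sdiff_subset ha).2 rfl

theorem sat_conjList {I : Set A} {l : List (InfFormula A)} :
    Sat I (conjList l) ↔ ∀ F ∈ l, Sat I F := by
  constructor
  · intro h F hF
    obtain ⟨i, rfl⟩ := List.get_of_mem hF
    exact h ⟨i⟩
  · exact fun h i => h _ (List.get_mem _ _)

end InfFormula

section Support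

variable {C : Type u₁} {G : Type u₂}

open InfFormula

/-- The atom in a head, if there is one. -/
def Head.IsAtom (h : Head C G) (A : Atom C G) : Prop := h = .basic A ∨ h = .choice A

/-- Removing `a` can falsify the reduct of a true head only through a conjunct whose atom belongs to
`I`, and that atom must then be `a`. -/
theorem Head.exists_of_not_sat_reduct {θ : G → PTerm C} {h : Head C G}
    {I : Set (GroundAtom C)} {a : GroundAtom C} (hI : Sat I (h.tau θ))
    (hJ : ¬ Sat (I \ {a}) (reduct I (h.tau θ))) :
    ∃ A, h.IsAtom A ∧ a.name = A.name ∧ a.args ∈ tupleValues θ A.args := by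
  cases h with
  | basic A =>
    refine ⟨A, .inl rfl, ?_⟩
    simp only [Head.tau, reduct, Sat, not_forall] at hJ
    obtain ⟨r, hr⟩ := hJ
    have hrI : (⟨A.name, r⟩ : GroundAtom C) ∈ I := hI r
    rw [if_pos hrI] at hr
    have : (⟨A.name, r⟩ : GroundAtom C) = a := by
      by_contra hne
      exact hr ⟨hrI, hne⟩
    subst this
    exact ⟨rfl, r.2⟩
  | choice A =>
    refine ⟨A, .inr rfl, ?_⟩
    simp only [Head.tau, reduct, Sat, not_forall] at hJ
    obtain ⟨r, hr⟩ := hJ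
    have hrI : (⟨A.name, r⟩ : GroundAtom C) ∈ I := by
      by_contra hrI
      -- For an atom outside `I` the reduct of its negation is `⊥ → ⊥`, so the second disjunct of
      -- the choice head holds everywhere.
      exact hr ⟨⟨false⟩, by simp [InfFormula.neg, reduct, Sat, hrI]⟩
    have : (⟨A.name, r⟩ : GroundAtom C) = a := by
      by_contra hne
      refine hr ⟨⟨true⟩, ?_⟩
      simp only [if_true, reduct, if_pos hrI]
      exact ⟨hrI, hne⟩
    subst this
    exact ⟨rfl, r.2⟩
  | constraint => exact hI.elim

variable [LinearOrder (PTerm C)]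

theorem Rule.sat_tau {θ : G → PTerm C} {R : Rule C G} {I : Set (GroundAtom C)} :
    Sat I (R.tau θ) ↔ ((∀ B ∈ R.body, Sat I (B.tau θ)) → Sat I (R.head.tau θ)) := by
  simp [Rule.tau, Sat, sat_conjList]

/-- Every atom of a stable model is supported by an instance of a rule. -/
theorem Program.IsStableModel.exists_support {P : Program C G} {S : Set (GroundAtom C)}
    (hS : P.IsStableModel S) {a : GroundAtom C} (ha : a ∈ S) :
    ∃ R ∈ P, ∃ θ : G → PTerm C, (∀ B ∈ R.body, Sat S (B.tau θ)) ∧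
      ∃ A, R.head.IsAtom A ∧ a.name = A.name ∧ a.args ∈ tupleValues θ A.args := by
  obtain ⟨F, hF, hJ⟩ := IsStable.exists_not_sat_reduct hS ha
  have hsat := IsStable.sat hS hF
  obtain ⟨R, hR, θ, rfl⟩ := hF
  unfold Rule.tau at hsat hJ
  rw [reduct, if_pos hsat] at hJ
  simp only [Sat, Classical.not_imp] at hJ
  -- The reduct of the body holds at `S \ {a}`; this is transferred to the body itself at `S`.
  have hbody := sat_of_sat_reduct _ hJ.1
  exact ⟨R, hR, θ, by simpa [sat_conjList] using hbody,
    Head.exists_of_not_sat_reduct (hsat hbody) hJ.2⟩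

end Support

/-! ### Values of critical variables -/

section Numerals

variable {C : Type u₁} {G : Type u₂} {θ : G → PTerm C}

theorem RTerm.mem_numerals_of_num_mem_values {t : RTerm G} {m : ℤ}
    (h : PTerm.num m ∈ t.values θ) : ∀ X ∈ t.vars, θ X ∈ numerals C := by
  induction t generalizing m with
  | num n => simp [RTerm.vars]
  | var X =>
    rintro _ rfl
    exact ⟨m, h⟩
  | add s t ihs iht | sub s t ihs iht | mul s t ihs iht =>
    obtain ⟨a, b, ha, hb, -⟩ := h
    rintro X (hX | hX)
    exacts [ihs ha X hX, iht hb X hX]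

/-- A lone variable may take a symbolic constant as its value; a compound term has a value only if
both operands have numeral values, and then the previous lemma applies to all variables in them. -/
theorem RTerm.mem_numerals_of_mem_values {t : RTerm G} {r : PTerm C}
    (h : r ∈ t.values θ) : ∀ X ∈ t.arithVars, θ X ∈ numerals C := by
  cases t with
  | num n => simp [RTerm.arithVars]
  | var X => simp [RTerm.arithVars]
  | add s t | sub s t | mul s t =>
    obtain ⟨a, b, ha, hb, -⟩ := h
    rintro X (hX | hX)
    exacts [mem_numerals_of_num_mem_values ha X hX, mem_numerals_of_num_mem_values hb X hX]

theorem Arg.mem_numerals_of_mem_values {t : Arg C G} {r : PTerm C}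
    (h : r ∈ t.values θ) : ∀ X ∈ t.arithVars, θ X ∈ numerals C := by
  cases t with
  | sym c => simp [Arg.arithVars]
  | term t => exact RTerm.mem_numerals_of_mem_values h

theorem Atom.mem_numerals_of_mem_tupleValues {A : Atom C G} {r : List (PTerm C)}
    (h : r ∈ tupleValues θ A.args) : ∀ X ∈ A.arithVars, θ X ∈ numerals C := by
  rintro X ⟨a, ha, hX⟩
  have h' : List.Forall₂ (fun a t => t ∈ a.values θ) A.args r := h
  obtain ⟨i, hi, rfl⟩ := List.getElem_of_mem ha
  exact Arg.mem_numerals_of_mem_values (h'.get hi (h'.length_eq ▸ hi)) X hX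

variable [LinearOrder (PTerm C)]

theorem Literal.mem_numerals_of_sat {S : Set (GroundAtom C)} {B : Literal C G}
    (h : InfFormula.Sat S (B.tau θ)) : ∀ X ∈ B.criticalVars, θ X ∈ numerals C := by
  cases B with
  | pos A | neg A =>
    obtain ⟨r, -⟩ := h
    exact Atom.mem_numerals_of_mem_tupleValues r.2
  | cmp c =>
    have hc : c.Holds θ := by
      by_contra hc
      simp [Literal.tau, hc, InfFormula.Sat] at h
    cases c with
    | eq s t | rel r s t =>
      obtain ⟨a, ha, b, hb, -⟩ := hc
      rintro X (hX | hX)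
      exacts [Arg.mem_numerals_of_mem_values ha X hX, Arg.mem_numerals_of_mem_values hb X hX]
    | interval t₁ t₂ t₃ =>
      obtain ⟨a, ha, b, ⟨m, n, k, hm, hn, -, -, rfl⟩, rfl⟩ := hc
      rintro X ((hX | hX) | hX)
      exacts [RTerm.mem_numerals_of_num_mem_values ha X hX,
        RTerm.mem_numerals_of_num_mem_values hm X hX,
        RTerm.mem_numerals_of_num_mem_values hn X hX]

end Numerals

theorem num_numeralValue {C : Type u₁} (a : numerals C) : PTerm.num (numeralValue a) = a.1 := by
  obtain ⟨_, n, rfl⟩ := a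
  rfl

/-! ### Natural translation and values of terms -/

section Natural

variable {C : Type u₁} {G : Type u₂} {N : Type u₃} [LinearOrder (PTerm C)]
  {P : Program C G} {S : Set (GroundAtom C)}

/-- The assignment `e` gives to the variable that replaces `X` in the natural translation the
value `θ X`. -/
def Assignment.Represents (e : Assignment G N (P.standard S)) (K : Set G) (f : G → N)
    (θ : G → PTerm C) : Prop :=
  ∀ X, (X ∈ K → ((e.int (f X) : numerals C) : PTerm C) = θ X) ∧ (X ∉ K → e.gen X = θ X)

open Classical in
theorem Assignment.exists_substitution (e : Assignment G N (P.standard S)) (K : Set G)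
    (f : G → N) : ∃ θ, e.Represents K f θ :=
  ⟨fun X => if X ∈ K then ((e.int (f X) : numerals C) : PTerm C) else e.gen X,
    fun _ => ⟨fun h => (if_pos h).symm, fun h => (if_neg h).symm⟩⟩

open Classical in
-- Distinct critical variables need distinct integer variables here, since they may have different
-- values under `θ`.
theorem Assignment.exists_represents {K : Set G} {f : G → N} (hf : Set.InjOn f K)
    {θ : G → PTerm C} (hθ : ∀ X ∈ K, θ X ∈ numerals C) :
    ∃ e : Assignment G N (P.standard S), e.Represents K f θ := by
  -- An integer variable takes the value of the critical variable that it replaces; the value 0 of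
  -- all others is arbitrary.
  refine ⟨⟨θ, fun I => if h : ∃ X ∈ K, f X = I then
    ⟨θ h.choose, hθ _ h.choose_spec.1⟩ else numeral 0⟩, fun X => ⟨fun hX => ?_, fun _ => rfl⟩⟩
  have h : ∃ Y ∈ K, f Y = f X := ⟨X, hX, rfl⟩
  simp only [dif_pos h]
  rw [hf h.choose_spec.1 hX h.choose_spec.2]

variable {e : Assignment G N (P.standard S)} {K : Set G} {f : G → N} {θ : G → PTerm C}

theorem RTerm.values_eq_toITerm (he : e.Represents K f θ) {t : RTerm G} (ht : t.vars ⊆ K) :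
    t.values θ = {(((t.toITerm f).eval e : numerals C) : PTerm C)} := by
  induction t with
  | num n => rfl
  | var _ => exact congrArg _ ((he _).1 (ht rfl)).symm
  | add s t ihs iht | sub s t ihs iht | mul s t ihs iht =>
    have hs := ihs fun X hX => ht (.inl hX)
    have ht := iht fun X hX => ht (.inr hX)
    -- Writing each element of `numerals C` as `PTerm.num` of its integer makes injectivity of
    -- `PTerm.num` applicable.
    simp only [RTerm.values, hs, ht, ← num_numeralValue, Set.mem_singleton_iff, PTerm.num.injEq]
    ext r
    constructor
    · rintro ⟨m, n, rfl, rfl, rfl⟩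
      rfl
    · rintro rfl
      exact ⟨_, _, rfl, rfl, rfl⟩

theorem RTerm.values_eq_natural (he : e.Represents K f θ) {t : RTerm G}
    (ht : t.arithVars ⊆ K) : t.values θ = {(t.natural K f).eval e} := by
  cases t with
  | num n => rfl
  | var X =>
    refine congrArg (fun r : PTerm C => ({r} : Set (PTerm C))) ?_
    by_cases hX : X ∈ K
    · simpa [RTerm.natural, hX, GTerm.eval, ITerm.eval] using ((he X).1 hX).symm
    · simpa [RTerm.natural, hX, GTerm.eval] using ((he X).2 hX).symm
  | add s t => exact RTerm.values_eq_toITerm (t := .add s t) he ht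
  | sub s t => exact RTerm.values_eq_toITerm (t := .sub s t) he ht
  | mul s t => exact RTerm.values_eq_toITerm (t := .mul s t) he ht

theorem RTerm.arithVars_subset_vars (t : RTerm G) : t.arithVars ⊆ t.vars := by
  cases t <;> simp [RTerm.arithVars, RTerm.vars]

/-- In an interval comparison even a lone variable is critical, so all three terms denote numerals
and the order between them is that of the integers. -/
theorem RTerm.exists_eval_natural_eq_num {t : RTerm G} (ht : t.vars ⊆ K) :
    ∃ m : ℤ, (t.natural K f).eval e = PTerm.num m := by
  cases t with
  | var X =>
    exact ⟨_, by simpa [RTerm.natural, ht rfl, GTerm.eval] using (num_numeralValue _).symm⟩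
  | _ => exact ⟨_, (num_numeralValue _).symm⟩

theorem Arg.values_eq_natural (he : e.Represents K f θ) {t : Arg C G}
    (ht : t.arithVars ⊆ K) : t.values θ = {(t.natural K f).eval e} := by
  cases t with
  | sym c => rfl
  | term t => exact RTerm.values_eq_natural he ht

theorem tupleValues_eq_natural (he : e.Represents K f θ) {l : List (Arg C G)}
    (hl : ∀ a ∈ l, a.arithVars ⊆ K) :
    tupleValues θ l = {(l.map (Arg.natural K f)).map (GTerm.eval e)} := by
  ext r
  simp only [tupleValues, Set.mem_ofPred_eq, Set.mem_singleton_iff]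
  induction l generalizing r with
  | nil => simp
  | cons a l ih =>
    have ih := fun r => ih (fun b hb => hl b (List.mem_cons_of_mem _ hb)) r
    simp only [List.forall₂_cons_left_iff, ih, Arg.values_eq_natural he (hl a List.mem_cons_self),
      Set.mem_singleton_iff, List.map_cons]
    exact ⟨fun ⟨_, _, h₁, h₂, h₃⟩ => by rw [h₃, h₁, h₂], fun h => ⟨_, _, rfl, rfl, h⟩⟩

theorem Atom.tupleValues_eq_natural (he : e.Represents K f θ) {A : Atom C G}
    (hA : A.arithVars ⊆ K) :
    tupleValues θ A.args = {(A.args.map (Arg.natural K f)).map (GTerm.eval e)} :=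
  RegularASP.tupleValues_eq_natural he fun a ha _ hX => hA ⟨a, ha, hX⟩

theorem Comparison.holds_natural_iff
    (num_lt_num : ∀ m n : ℤ, (PTerm.num m : PTerm C) < PTerm.num n ↔ m < n)
    (he : e.Represents K f θ) {c : Comparison C G} (hc : c.criticalVars ⊆ K) :
    (c.natural K f : Formula C G N P.predSyms).Holds (P.standard S) e ↔ c.Holds θ := by
  cases c with
  | eq s t | rel r s t =>
    have hs := Arg.values_eq_natural he fun X hX => hc (.inl hX)
    have ht := Arg.values_eq_natural he fun X hX => hc (.inr hX)
    simp [Comparison.natural, Formula.Holds, Comparison.Holds, hs, ht]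
  | interval t₁ t₂ t₃ =>
    have h₁ : t₁.vars ⊆ K := fun X hX => hc (.inl (.inl hX))
    have h₂ : t₂.vars ⊆ K := fun X hX => hc (.inl (.inr hX))
    have h₃ : t₃.vars ⊆ K := fun X hX => hc (.inr hX)
    have num_le_num (m n : ℤ) : (PTerm.num m : PTerm C) ≤ PTerm.num n ↔ m ≤ n := by
      rw [← not_lt, num_lt_num, not_lt]
    obtain ⟨k, hk⟩ := RTerm.exists_eval_natural_eq_num (f := f) (e := e) h₁
    obtain ⟨m, hm⟩ := RTerm.exists_eval_natural_eq_num (f := f) (e := e) h₂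
    obtain ⟨n, hn⟩ := RTerm.exists_eval_natural_eq_num (f := f) (e := e) h₃
    have v₁ := RTerm.values_eq_natural he ((RTerm.arithVars_subset_vars t₁).trans h₁)
    have v₂ := RTerm.values_eq_natural he ((RTerm.arithVars_subset_vars t₂).trans h₂)
    have v₃ := RTerm.values_eq_natural he ((RTerm.arithVars_subset_vars t₃).trans h₃)
    rw [hk] at v₁
    rw [hm] at v₂
    rw [hn] at v₃
    simp [Comparison.natural, Formula.Holds, Comparison.Holds, intervalValues, v₁, v₂, v₃,
      hk, hm, hn, Rel.Holds, num_le_num]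

theorem Literal.holds_natural_iff
    (num_lt_num : ∀ m n : ℤ, (PTerm.num m : PTerm C) < PTerm.num n ↔ m < n)
    (he : e.Represents K f θ) {B : Literal C G} (hB : B.criticalVars ⊆ K)
    (h : B.predSyms ⊆ P.predSyms) :
    (B.natural K f h : Formula C G N P.predSyms).Holds (P.standard S) e ↔
      InfFormula.Sat S (B.tau θ) := by
  cases B with
  | pos A | neg A =>
    have hA := Atom.tupleValues_eq_natural he hB
    simp only [Literal.tau, InfFormula.Sat, InfFormula.neg, Subtype.exists, hA,
      Set.mem_singleton_iff, exists_prop, exists_eq_left, Literal.natural, Formula.Holds,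
      Formula.neg, Atom.natural]
  | cmp c =>
    rw [Literal.natural, Comparison.holds_natural_iff num_lt_num he hB]
    by_cases hc : c.Holds θ <;> simp [Literal.tau, InfFormula.Sat, InfFormula.verum, hc]

end Natural

/-! ### Semantics of derived connectives -/

namespace Formula

variable {C : Type u₁} {G : Type u₂} {N : Type u₃} {σ : Set (PredSym C)}
  {M : Interpretation.{u₁, u₄} C σ}

theorem holds_bigAnd {l : List (Formula C G N σ)} {e : Assignment G N M} :
    (bigAnd l).Holds M e ↔ ∀ φ ∈ l, φ.Holds M e := by
  induction l with
  | nil => simp [bigAnd, verum, neg, Holds]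
  | cons φ l ih => simp [bigAnd, Holds, ih]

theorem holds_bigOr {l : List (Formula C G N σ)} {e : Assignment G N M} :
    (bigOr l).Holds M e ↔ ∃ φ ∈ l, φ.Holds M e := by
  induction l with
  | nil => simp [bigOr, Holds]
  | cons φ l ih => simp [bigOr, Holds, ih]

/-- Equal lengths matter because `List.zipWith` silently drops the excess of the longer list. -/
theorem holds_eqTuple {l l' : List (GTerm C G N)} (h : l.length = l'.length)
    {e : Assignment G N M} :
    (eqTuple l l' : Formula C G N σ).Holds M e ↔
      l.map (GTerm.eval e) = l'.map (GTerm.eval e) := by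
  induction l generalizing l' with
  | nil => cases l' <;> simp_all [eqTuple, bigAnd, verum, neg, Holds]
  | cons s l ih =>
    cases l' with
    | nil => simp at h
    | cons t l' =>
      have := ih (l' := l') (by simpa using h)
      simp only [eqTuple] at this
      simp [eqTuple, bigAnd, Holds, this]

end Formula

/-! ### Dependence on free variables and blocks of quantifiers -/

section Coincidence

variable {C : Type u₁} {G : Type u₂} {N : Type u₃} {σ : Set (PredSym C)}
  {M : Interpretation.{u₁, u₄} C σ}

/-- Two assignments give the same value to the variable `x`. -/
def Assignment.AgreeAt (e e' : Assignment G N M) : Var G N → Prop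
  | .gen X => e.gen X = e'.gen X
  | .int I => e.int I = e'.int I

theorem ITerm.eval_congr {e e' : Assignment G N M} {t : ITerm N}
    (h : ∀ x ∈ (t.vars : List (Var G N)), e.AgreeAt e' x) : t.eval e = t.eval e' := by
  induction t with
  | num n => rfl
  | var I => exact h (.int I) (by simp [ITerm.vars])
  | add s t ihs iht | sub s t ihs iht | mul s t ihs iht =>
    simp only [ITerm.vars, List.mem_append] at h
    rw [ITerm.eval, ITerm.eval, ihs fun x hx => h x (.inl hx), iht fun x hx => h x (.inr hx)]

theorem GTerm.eval_congr {e e' : Assignment G N M} {t : GTerm C G N}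
    (h : ∀ x ∈ t.vars, e.AgreeAt e' x) : t.eval e = t.eval e' := by
  cases t with
  | sym c => rfl
  | var X => exact h (.gen X) (by simp [GTerm.vars])
  | int t => exact congrArg Subtype.val (ITerm.eval_congr h)

theorem GTerm.map_eval_congr {e e' : Assignment G N M} {l : List (GTerm C G N)}
    (h : ∀ x ∈ l.flatMap GTerm.vars, e.AgreeAt e' x) :
    l.map (GTerm.eval e) = l.map (GTerm.eval e') :=
  List.map_congr_left fun t ht =>
    GTerm.eval_congr fun x hx => h x (List.mem_flatMap.2 ⟨t, ht, hx⟩)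

theorem Assignment.AgreeAt.setGen {e e' : Assignment G N M} {X : G} {x : Var G N} (a : M.Gen)
    (h : x ≠ .gen X → e.AgreeAt e' x) : (e.setGen X a).AgreeAt (e'.setGen X a) x := by
  cases x with
  | gen Y =>
    by_cases hY : Y = X
    · subst hY
      simp [AgreeAt, Assignment.setGen]
    · simpa [AgreeAt, Assignment.setGen, hY] using h (by simpa using hY)
  | int I => exact h (by simp)

theorem Assignment.AgreeAt.setInt {e e' : Assignment G N M} {I : N} {x : Var G N} (a : M.Int)
    (h : x ≠ .int I → e.AgreeAt e' x) : (e.setInt I a).AgreeAt (e'.setInt I a) x := by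
  cases x with
  | int J =>
    by_cases hJ : J = I
    · subst hJ
      simp [AgreeAt, Assignment.setInt]
    · simpa [AgreeAt, Assignment.setInt, hJ] using h (by simpa using hJ)
  | gen X => exact h (by simp)

theorem Formula.holds_congr {φ : Formula C G N σ} {e e' : Assignment G N M}
    (h : ∀ x ∈ φ.freeVars, e.AgreeAt e' x) : φ.Holds M e ↔ φ.Holds M e' := by
  induction φ generalizing e e' with
  | falsum => rfl
  | eq s t | rel r s t =>
    simp only [freeVars, List.mem_append] at h
    rw [Holds, Holds, GTerm.eval_congr fun x hx => h x (.inl hx),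
      GTerm.eval_congr fun x hx => h x (.inr hx)]
  | pred p args hp =>
    simp only [Holds, GTerm.map_eval_congr h]
  | and φ ψ ihφ ihψ | or φ ψ ihφ ihψ | imp φ ψ ihφ ihψ =>
    simp only [freeVars, List.mem_append] at h
    rw [Holds, Holds, ihφ fun x hx => h x (.inl hx), ihψ fun x hx => h x (.inr hx)]
  | all y φ ih =>
    simp only [freeVars, List.mem_filter, decide_eq_true_eq] at h
    cases y with
    | gen X => exact forall_congr' fun a => ih fun x hx => .setGen a fun hne => h x ⟨hx, hne⟩
    | int I => exact forall_congr' fun a => ih fun x hx => .setInt a fun hne => h x ⟨hx, hne⟩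
  | ex y φ ih =>
    simp only [freeVars, List.mem_filter, decide_eq_true_eq] at h
    cases y with
    | gen X => exact exists_congr fun a => ih fun x hx => .setGen a fun hne => h x ⟨hx, hne⟩
    | int I => exact exists_congr fun a => ih fun x hx => .setInt a fun hne => h x ⟨hx, hne⟩

open Classical in
/-- The assignment that takes the values of the variables in `l` from `e'` and those of the
other variables from `e`. -/
noncomputable def Assignment.overwrite (e e' : Assignment G N M) (l : List (Var G N)) :
    Assignment G N M :=
  ⟨fun X => if .gen X ∈ l then e'.gen X else e.gen X,
    fun I => if .int I ∈ l then e'.int I else e.int I⟩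

theorem Assignment.overwrite_agreeAt_of_mem (e e' : Assignment G N M) {l : List (Var G N)}
    {x : Var G N} (hx : x ∈ l) : (e.overwrite e' l).AgreeAt e' x := by
  cases x <;> simp [AgreeAt, overwrite, hx]

theorem Assignment.overwrite_agreeAt_of_notMem (e e' : Assignment G N M) {l : List (Var G N)}
    {x : Var G N} (hx : x ∉ l) : (e.overwrite e' l).AgreeAt e x := by
  cases x <;> simp [AgreeAt, overwrite, hx]

theorem Assignment.overwrite_nil (e e' : Assignment G N M) : e.overwrite e' [] = e := by
  simp [overwrite]

open Classical in
-- Peels off the outermost quantifier of a block. A repetition of `X` in `l` is harmless, as it is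
-- overwritten by the same value.
theorem Assignment.overwrite_cons_gen (e e' : Assignment G N M) (X : G) (l : List (Var G N)) :
    e.overwrite e' (.gen X :: l) = (e.setGen X (e'.gen X)).overwrite e' l := by
  refine Assignment.mk.injEq .. ▸ ⟨funext fun Y => ?_, funext fun J => ?_⟩
  · by_cases hY : Y = X
    · subst hY
      simp [setGen]
    · simp [setGen, hY]
  · exact if_congr (by simp) rfl rfl

open Classical in
theorem Assignment.overwrite_cons_int (e e' : Assignment G N M) (I : N) (l : List (Var G N)) :
    e.overwrite e' (.int I :: l) = (e.setInt I (e'.int I)).overwrite e' l := by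
  refine Assignment.mk.injEq .. ▸ ⟨funext fun Y => ?_, funext fun J => ?_⟩
  · exact if_congr (by simp) rfl rfl
  · by_cases hJ : J = I
    · subst hJ
      simp [setInt]
    · simp [setInt, hJ]

/-- Supplies all witnesses of a block of existential quantifiers at once, from the single assignment
`e'`. -/
theorem Formula.holds_exList_of_overwrite {l : List (Var G N)} {φ : Formula C G N σ}
    {e : Assignment G N M} (e' : Assignment G N M) (h : φ.Holds M (e.overwrite e' l)) :
    (exList l φ).Holds M e := by
  induction l generalizing e with
  | nil => rwa [Assignment.overwrite_nil] at h
  | cons x l ih =>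
    cases x with
    | gen X => exact ⟨e'.gen X, ih (by rwa [← Assignment.overwrite_cons_gen])⟩
    | int I => exact ⟨e'.int I, ih (by rwa [← Assignment.overwrite_cons_int])⟩

theorem Formula.exists_of_holds_exList {l : List (Var G N)} {φ : Formula C G N σ}
    {e : Assignment G N M} (h : (exList l φ).Holds M e) :
    ∃ e' : Assignment G N M, (∀ x ∉ l, e'.AgreeAt e x) ∧ φ.Holds M e' := by
  induction l generalizing e with
  | nil => exact ⟨e, fun x _ => by cases x <;> rfl, h⟩
  | cons x l ih =>
    cases x with
    | gen X =>
      obtain ⟨a, ha⟩ := h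
      obtain ⟨e', he', hφ⟩ := ih ha
      refine ⟨e', fun y hy => ?_, hφ⟩
      simp only [List.mem_cons, not_or] at hy
      have := he' y hy.2
      cases y with
      | gen Y =>
        have hY : Y ≠ X := fun h => hy.1 (h ▸ rfl)
        simpa [Assignment.AgreeAt, Assignment.setGen, hY] using this
      | int J => exact this
    | int I =>
      obtain ⟨a, ha⟩ := h
      obtain ⟨e', he', hφ⟩ := ih ha
      refine ⟨e', fun y hy => ?_, hφ⟩
      simp only [List.mem_cons, not_or] at hy
      have := he' y hy.2
      cases y with
      | int J =>
        have hJ : J ≠ I := fun h => hy.1 (h ▸ rfl)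
        simpa [Assignment.AgreeAt, Assignment.setInt, hJ] using this
      | gen Y => exact this

theorem Formula.holds_allList {l : List (Var G N)} {φ : Formula C G N σ}
    (h : ∀ e, φ.Holds M e) (e : Assignment G N M) : (allList l φ).Holds M e := by
  induction l generalizing e with
  | nil => exact h e
  | cons x l ih =>
    cases x with
    | gen X => exact fun a => ih _
    | int I => exact fun a => ih _

end Coincidence

/-! ### General variables of the natural translation -/

section FreeVars

variable {C : Type u₁} {G : Type u₂} {N : Type u₃} {σ : Set (PredSym C)} {K : Set G} {f : G → N}
  {X : G}

theorem ITerm.gen_notMem_vars (t : ITerm N) : Var.gen X ∉ t.vars := by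
  induction t <;> simp_all [ITerm.vars]

theorem RTerm.mem_vars_of_gen_mem_natural {t : RTerm G}
    (h : Var.gen X ∈ (t.natural K f : GTerm C G N).vars) : X ∈ t.vars := by
  cases t with
  | var Y =>
    by_cases hY : Y ∈ K
    · simp [RTerm.natural, hY, GTerm.vars, ITerm.vars] at h
    · simpa [RTerm.natural, hY, GTerm.vars, RTerm.vars] using h
  | _ => exact (ITerm.gen_notMem_vars _ h).elim

theorem Arg.mem_vars_of_gen_mem_natural {t : Arg C G}
    (h : Var.gen X ∈ (t.natural K f).vars) : X ∈ t.vars := by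
  cases t with
  | sym c => simp [Arg.natural, GTerm.vars] at h
  | term t => exact RTerm.mem_vars_of_gen_mem_natural h

theorem Atom.mem_vars_of_gen_mem_natural {A : Atom C G}
    (h : Var.gen X ∈ (A.args.map (Arg.natural K f)).flatMap GTerm.vars) : X ∈ A.vars := by
  simp only [List.mem_flatMap, List.mem_map, exists_exists_and_eq_and] at h
  obtain ⟨a, ha, hX⟩ := h
  exact ⟨a, ha, Arg.mem_vars_of_gen_mem_natural hX⟩

theorem Literal.mem_vars_of_gen_mem_natural {B : Literal C G} {hB : B.predSyms ⊆ σ}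
    (h : Var.gen X ∈ (B.natural K f hB).freeVars) : X ∈ B.vars := by
  cases B with
  | pos A => exact Atom.mem_vars_of_gen_mem_natural h
  | neg A =>
    simp only [Literal.natural, Formula.neg, Formula.freeVars, List.append_nil] at h
    exact Atom.mem_vars_of_gen_mem_natural h
  | cmp c =>
    cases c with
    | eq s t | rel r s t =>
      simp only [Literal.natural, Comparison.natural, Formula.freeVars, List.mem_append] at h
      exact h.imp Arg.mem_vars_of_gen_mem_natural Arg.mem_vars_of_gen_mem_natural
    | interval t₁ t₂ t₃ =>
      simp only [Literal.natural, Comparison.natural, Formula.freeVars, List.mem_append] at h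
      rcases h with (h | h) | (h | h)
      · exact .inl (.inr (RTerm.mem_vars_of_gen_mem_natural h))
      · exact .inl (.inl (RTerm.mem_vars_of_gen_mem_natural h))
      · exact .inl (.inl (RTerm.mem_vars_of_gen_mem_natural h))
      · exact .inr (RTerm.mem_vars_of_gen_mem_natural h)

theorem Formula.exists_of_mem_freeVars_bigAnd {l : List (Formula C G N σ)} {x : Var G N}
    (h : x ∈ (bigAnd l).freeVars) : ∃ φ ∈ l, x ∈ φ.freeVars := by
  induction l with
  | nil => simp [bigAnd, verum, neg, freeVars] at h
  | cons φ l ih =>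
    simp only [bigAnd, freeVars, List.mem_append] at h
    rcases h with h | h
    · exact ⟨φ, List.mem_cons_self, h⟩
    · obtain ⟨ψ, hψ, hx⟩ := ih h
      exact ⟨ψ, List.mem_cons_of_mem _ hψ, hx⟩

/-- Turns freshness of `V` with respect to the program into the absence of capture by `∃ U_R`. -/
theorem Rule.mem_vars_of_gen_mem_completionVars {R : Rule C G} {hR : R.predSyms ⊆ σ}
    (h : Var.gen X ∈ R.completionVars f hR) : X ∈ R.vars := by
  simp only [Rule.completionVars, List.mem_dedup, List.mem_append] at h
  rcases h with h | h
  · obtain ⟨φ, hφ, hX⟩ := Formula.exists_of_mem_freeVars_bigAnd h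
    simp only [List.mem_map] at hφ
    obtain ⟨B, -, rfl⟩ := hφ
    exact .inr ⟨B.1, B.2, Literal.mem_vars_of_gen_mem_natural hX⟩
  · refine .inl ?_
    unfold Rule.naturalHeadArgs at h
    cases hh : R.head with
    | basic A | choice A =>
      rw [hh] at h
      exact Atom.mem_vars_of_gen_mem_natural h
    | constraint =>
      rw [hh] at h
      simp at h

theorem Rule.length_naturalHeadArgs {R : Rule C G} {A : Atom C G} (hA : R.head.IsAtom A)
    (f : G → N) : (R.naturalHeadArgs f).length = A.args.length := by
  rcases hA with hA | hA <;> simp [Rule.naturalHeadArgs, hA]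

theorem Head.mem_predSyms_iff {h : Head C G} {q : PredSym C} :
    q ∈ h.predSyms ↔ ∃ A, h.IsAtom A ∧ q = A.predSym := by
  cases h <;> simp [Head.predSyms, Head.IsAtom]

end FreeVars

/-! ### Stable models satisfy the natural completion -/

section Main

variable {C : Type u₁} {G : Type u₂} {N : Type u₃} [LinearOrder (PTerm C)]
  {P : Program C G} {S : Set (GroundAtom C)}

theorem Rule.holds_naturalBody_iff
    (num_lt_num : ∀ m n : ℤ, (PTerm.num m : PTerm C) < PTerm.num n ↔ m < n)
    {R : Rule C G} (hR : R.predSyms ⊆ P.predSyms) {f : G → N}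
    {e : Assignment G N (P.standard S)} {θ : G → PTerm C}
    (he : e.Represents R.criticalVars f θ) :
    (R.naturalBody f hR).Holds (P.standard S) e ↔
      ∀ B ∈ R.body, InfFormula.Sat S (B.tau θ) := by
  have key (B : Literal C G) (hB : B ∈ R.body) :=
    Literal.holds_natural_iff num_lt_num he (B := B) (fun X hX => .inr ⟨B, hB, hX⟩)
      (Rule.predSyms_of_mem_body hR hB)
  rw [Rule.naturalBody, Formula.holds_bigAnd, List.forall_mem_map]
  exact ⟨fun h B hB => (key B hB).1 (h ⟨B, hB⟩ (List.mem_attach ..)),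
    fun h B _ => (key B.1 B.2).2 (h B.1 B.2)⟩

theorem Rule.tupleValues_head {R : Rule C G} {A : Atom C G} (hA : R.head.IsAtom A) {f : G → N}
    {e : Assignment G N (P.standard S)} {θ : G → PTerm C}
    (he : e.Represents R.criticalVars f θ) :
    tupleValues θ A.args = {(R.naturalHeadArgs f).map (GTerm.eval e)} := by
  have hcrit : A.arithVars ⊆ R.criticalVars := fun X hX => .inl <| by
    rcases hA with hA | hA <;> rw [hA] <;> exact hX
  have hargs : R.naturalHeadArgs f = A.args.map (Arg.natural R.criticalVars f) := by
    rcases hA with hA | hA <;> simp only [Rule.naturalHeadArgs, hA]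
  rw [hargs]
  exact Atom.tupleValues_eq_natural he hcrit

theorem Program.IsStableModel.satisfies_completedDefinition
    (num_lt_num : ∀ m n : ℤ, (PTerm.num m : PTerm C) < PTerm.num n ↔ m < n)
    (hS : P.IsStableModel S) (c : CompletionChoice P N) {q : PredSym C}
    (hq : q ∈ P.predSyms) : (P.standard S).Satisfies (completedDefinition P c q hq) := by
  refine Formula.holds_allList fun e => ?_
  have hlen : (c.terms q : List (GTerm C G N)).length = q.arity := by
    simp [CompletionChoice.terms]
  refine ⟨fun hatom => ?_, fun hdef => ?_⟩
  · obtain ⟨R, hR, θ, hbody, A, hA, hname, hargs⟩ := hS.exists_support hatom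
    have hqA : q = A.predSym := by
      refine PredSym.ext hname ?_
      have := List.Forall₂.length_eq hargs
      simpa [hlen, Atom.predSym] using this.symm
    have hθ : ∀ X ∈ R.criticalVars, θ X ∈ numerals C := by
      rintro X (hX | ⟨B, hB, hX⟩)
      · refine Atom.mem_numerals_of_mem_tupleValues hargs X ?_
        rcases hA with hA | hA <;> rw [hA] at hX <;> exact hX
      · exact Literal.mem_numerals_of_sat (hbody B hB) X hX
    obtain ⟨e', he'⟩ := Assignment.exists_represents (P := P) (S := S) (c.f_injOn R hR) hθ
    have hsub := Program.predSyms_of_mem hR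
    rw [Formula.holds_bigOr]
    refine ⟨_, List.mem_map.2 ⟨⟨R, hR⟩, ?_, rfl⟩, ?_⟩
    · simpa [Program.definition, Head.mem_predSyms_iff] using ⟨A, hA, hqA⟩
    -- The bound variables take the values given by the supporting instance, while `V` keeps its
    -- values under `e`.
    refine Formula.holds_exList_of_overwrite e' ?_
    set l := R.completionVars (c.f R) hsub with hl
    have hV : (c.terms q).map (GTerm.eval (e.overwrite e' l)) =
        (c.terms q).map (GTerm.eval e) := by
      refine GTerm.map_eval_congr fun x hx => ?_
      simp only [CompletionChoice.terms, List.mem_flatMap, List.mem_ofFn] at hx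
      obtain ⟨_, ⟨i, rfl⟩, hx⟩ := hx
      obtain rfl := List.mem_singleton.1 hx
      exact Assignment.overwrite_agreeAt_of_notMem _ _ fun h =>
        c.V_fresh q hq i ⟨R, hR, Rule.mem_vars_of_gen_mem_completionVars h⟩
    have hb : (R.naturalBody (c.f R) hsub).Holds (P.standard S) (e.overwrite e' l) := by
      refine (Formula.holds_congr fun x hx => ?_).2
        ((Rule.holds_naturalBody_iff num_lt_num hsub he').2 hbody)
      exact Assignment.overwrite_agreeAt_of_mem _ _ (by simp [hl, Rule.completionVars, hx])
    have ht : (R.naturalHeadArgs (c.f R)).map (GTerm.eval (e.overwrite e' l)) =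
        (R.naturalHeadArgs (c.f R)).map (GTerm.eval e') :=
      GTerm.map_eval_congr fun x hx =>
        Assignment.overwrite_agreeAt_of_mem _ _ <| by
          simp only [hl, Rule.completionVars, List.mem_dedup, List.mem_append]
          exact .inr hx
    have heq : (Formula.eqTuple (c.terms q) (R.naturalHeadArgs (c.f R)) :
        Formula C G N P.predSyms).Holds (P.standard S) (e.overwrite e' l) := by
      rw [Formula.holds_eqTuple (by rw [hlen, Rule.length_naturalHeadArgs hA, hqA]; rfl), hV, ht]
      rw [Rule.tupleValues_head hA he'] at hargs
      exact hargs
    have hp : (c.atom q hq).Holds (P.standard S) (e.overwrite e' l) := by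
      simp only [CompletionChoice.atom, Formula.Holds, hV]
      exact hatom
    rcases hA with hA | hA
    · simp only [Rule.completionBody, hA]
      exact ⟨hb, heq⟩
    · simp only [Rule.completionBody, hA]
      exact ⟨⟨hb, heq⟩, hp⟩
  · obtain ⟨_, hmem, hex⟩ := Formula.holds_bigOr.1 hdef
    obtain ⟨⟨R, hR⟩, hRq, rfl⟩ := List.mem_map.1 hmem
    obtain ⟨A, hA, hqA⟩ : ∃ A, R.head.IsAtom A ∧ q = A.predSym := by
      simpa [Program.definition, Head.mem_predSyms_iff] using hRq
    obtain ⟨e', hagree, hbody⟩ := Formula.exists_of_holds_exList hex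
    have hV : (c.terms q).map (GTerm.eval e') = (c.terms q).map (GTerm.eval e) := by
      refine GTerm.map_eval_congr fun x hx => ?_
      simp only [CompletionChoice.terms, List.mem_flatMap, List.mem_ofFn] at hx
      obtain ⟨_, ⟨i, rfl⟩, hx⟩ := hx
      obtain rfl := List.mem_singleton.1 hx
      exact hagree _ fun h =>
        c.V_fresh q hq i ⟨R, hR, Rule.mem_vars_of_gen_mem_completionVars h⟩
    -- By `hV`, the truth value of `p(V)` is the same under `e` and `e'`.
    suffices hp : (c.atom q hq).Holds (P.standard S) e' by
      simp only [CompletionChoice.atom, Formula.Holds, hV] at hp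
      exact hp
    have hhead := hA
    rcases hhead with hA' | hA'
    · simp only [Rule.completionBody, hA'] at hbody
      obtain ⟨hb, heq⟩ := hbody
      -- The witnesses of `∃ U_R` are read as a ground instance of `R`, which `S` satisfies.
      obtain ⟨θ, hθ⟩ := e'.exists_substitution R.criticalVars (c.f R)
      rw [Formula.holds_eqTuple (by rw [hlen, Rule.length_naturalHeadArgs hA, hqA]; rfl)] at heq
      have hmodel := Rule.sat_tau.1 (InfFormula.IsStable.sat hS ⟨R, hR, θ, rfl⟩)
        ((Rule.holds_naturalBody_iff num_lt_num _ hθ).1 hb)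
      rw [hA'] at hmodel
      have := hmodel ⟨(c.terms q).map (GTerm.eval e'), by
        rw [Rule.tupleValues_head hA hθ, heq]
        rfl⟩
      subst hqA
      exact this
    · simp only [Rule.completionBody, hA'] at hbody
      -- A choice rule forces nothing; here `p(V)` is itself a conjunct of `F_R`.
      exact hbody.2

theorem Program.IsStableModel.satisfies_constraint
    (num_lt_num : ∀ m n : ℤ, (PTerm.num m : PTerm C) < PTerm.num n ↔ m < n)
    (hS : P.IsStableModel S) {R : Rule C G} (hR : R ∈ P) (hhead : R.head = .constraint)
    (f : G → N) : (P.standard S).Satisfies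
      (Formula.closure (.neg (R.naturalBody f (Program.predSyms_of_mem hR)))) := by
  -- The body is refuted under every assignment, so it does not matter which variables the closure
  -- binds.
  refine Formula.holds_allList fun e hb => ?_
  obtain ⟨θ, hθ⟩ := e.exists_substitution R.criticalVars f
  have hmodel := Rule.sat_tau.1 (InfFormula.IsStable.sat hS ⟨R, hR, θ, rfl⟩)
    ((Rule.holds_naturalBody_iff num_lt_num _ hθ).1 hb)
  rw [hhead] at hmodel
  exact hmodel

end Main

end RegularASP

theorem theorem1 {C : Type*} {G : Type*} {N : Type*}
    [Countable C] [Infinite C] [Countable G] [Infinite G] [Countable N] [Infinite N]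
    [LinearOrder (PTerm C)]
    (num_lt_num : ∀ m n : ℤ, (PTerm.num m : PTerm C) < PTerm.num n ↔ m < n)
    (num_of_between : ∀ (m n : ℤ) (t : PTerm C),
      PTerm.num m < t → t < PTerm.num n → ∃ k : ℤ, t = PTerm.num k)
    (P : Program C G) (S : Set (GroundAtom C)) (hS : S ⊆ P.herbrandBase)
    (hstable : P.IsStableModel S) (c : CompletionChoice P N) :
    ∀ φ ∈ NCOMP P c, (P.standard S).Satisfies φ := by
  rintro φ (⟨q, hq, rfl⟩ | ⟨R, hR, hhead, rfl⟩)
  · exact hstable.satisfies_completedDefinition num_lt_num c hq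
  · exact hstable.satisfies_constraint num_lt_num hR hhead (c.f R)
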